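/- By an affine Dynkin diagram we mean one of the graphs $\tilde A_n$ ($n\ge 1$; a cycle with $n+1$ vertices and $n+1$ edges, $\tilde A_1$ being two vertices joined by two edges), $\tilde D_n$ ($n\ge 4$), $\tilde E_6$, $\tilde E_7$, $\tilde E_8$. The double quiver of a graph has, for each edge between $i$ and $j$, one arrow $i\to j$ and one arrow $j\to i$. Let $G$ be a finite group with a finite dimensional complex representation $V$. The McKay quiver $Q_G$ has as vertices the isomorphism classes of irreducible complex representations $S_i$ of $G$, and has $a_{i,j}$ arrows from $i$ to $j$, where $a_{i,j}=\dim_{\mathbb C}\operatorname{Hom}_G(S_j,V\otimes S_i)$ is the multiplicity of $S_j$ in $V\otimes S_i$. The irreducible representations of $G$ are the simple left modules over the skew group algebra $\bigwedge V * G$ (with $V$ acting as zero); the Nakayama translation $\sigma$ is the permutation of the vertices such that $S_{\sigma i}$ is the socle of the projective cover of $S_i$ over $\bigwedge V*G$. Subgroups of $\mathbb C^*=\mathrm{GL}(1,\mathbb C)$ act on $V=\mathbb C$, and subgroups of $\mathrm{SL}(2,\mathbb C)$ act on $V=\mathbb C^2$, in the natural way. For a finite subgroup $G'\subset\mathbb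 C^*$, replacing the Nakayama translation with arrows in $Q_{G'}$ means adding to $Q_{G'}$, for each vertex $i$, one arrow from $\sigma i$ to $i$. **Proposition.** Let $\Gamma$ be an affine Dynkin diagram. The double quiver of $\Gamma$ is isomorphic to a quiver obtained from the McKay quiver of some finite subgroup $G'$ of $\mathbb C^*$ by replacing the Nakayama translation with arrows if and only if $\Gamma$ is of type $\tilde A_n$ for some $n\ge 1$. Moreover, for every finite subgroup $G'\subset\mathbb C^*$ for which the double quiver of $\Gamma$ is obtained in this way from $Q_{G'}$, it is isomorphic to the McKay quiver of the subgroup $\{\operatorname{diag}(z,z^{-1}) : z\in G'\}$ of $\mathrm{SL}(2,\mathbb C)$. -/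

import Mathlib

open scoped TensorProduct

noncomputable section

/-! ### Quivers, multigraphs and double quivers -/

/-- An isomorphism of quivers: a bijection of vertices together with bijections of the sets of
arrows. -/
structure QuiverIso (U V : Type*) [Quiver U] [Quiver V] where
  obj : U ≃ V
  hom : ∀ i j : U, (i ⟶ j) ≃ (obj i ⟶ obj j)

/-- An undirected graph without loops, multiple edges being allowed. -/
structure Multigraph where
  /-- the vertices -/
  Vert : Type
  /-- the edges -/
  Edge : Type
  /-- the unordered pair of end points of an edge -/
  ends : Edge → Sym2 Vert
  loopless : ∀ e, ¬ (ends e).IsDiag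

/-- An isomorphism of multigraphs. -/
structure Multigraph.Iso (Γ Δ : Multigraph) where
  vert : Γ.Vert ≃ Δ.Vert
  edge : Γ.Edge ≃ Δ.Edge
  ends_edge : ∀ e, Δ.ends (edge e) = (Γ.ends e).map vert

/-- The vertices of the double quiver of a multigraph. -/
def Multigraph.Double (Γ : Multigraph) : Type := Γ.Vert

/-- The double quiver of a multigraph: each edge between `i` and `j` gives
one arrow from `i` to `j` and one arrow from `j` to `i`. -/
instance (Γ : Multigraph) : Quiver Γ.Double where
  Hom i j := {e : Γ.Edge // Γ.ends e = Sym2.mk (α := Γ.Vert) i j}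

/-! ### The affine Dynkin diagrams of type `Ã`, `D̃`, `Ẽ` -/

/-- The diagram `Ã_n`, `n ≥ 1`: a cycle with `n + 1` vertices and `n + 1` edges
(for `n = 1` two vertices joined by two edges). -/
def affineA (n : ℕ) (hn : 1 ≤ n) : Multigraph where
  Vert := Fin (n + 1)
  Edge := Fin (n + 1)
  ends i := s(i, i + 1)
  loopless i h := by
    have h1 : (1 : Fin (n + 1)) = 0 := by simpa using h
    have : NeZero n := ⟨by omega⟩
    have h2 := congrArg Fin.val h1
    simp [Nat.mod_eq_of_lt (show 1 < n + 1 by omega)] at h2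

/-- The diagram `D̃_n`, `n ≥ 4`, with `n + 1` vertices `0, …, n`: the path
`1 — 2 — ⋯ — (n - 1)`, with the vertex `0` attached to `2` and the vertex `n` attached
to `n - 2`. -/
def affineD (n : ℕ) (hn : 4 ≤ n) : Multigraph where
  Vert := Fin (n + 1)
  Edge := Fin n
  ends e :=
    if e.val = 0 then s(⟨0, by omega⟩, ⟨2, by omega⟩)
    else if e.val = n - 1 then s(⟨n - 2, by omega⟩, ⟨n, by omega⟩)
    else s(⟨e.val, by omega⟩, ⟨e.val + 1, by omega⟩)
  loopless e h := by
    split_ifs at h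
    all_goals simp at h
    all_goals omega

/-- The diagram `Ẽ₆`: three arms of length `2`. -/
def affineE6 : Multigraph where
  Vert := Fin 7
  Edge := Fin 6
  ends := ![s(0, 1), s(1, 2), s(0, 3), s(3, 4), s(0, 5), s(5, 6)]
  loopless := by decide

/-- The diagram `Ẽ₇`: arms of length `3`, `3`, `1`. -/
def affineE7 : Multigraph where
  Vert := Fin 8
  Edge := Fin 7
  ends := ![s(0, 1), s(1, 2), s(2, 3), s(0, 4), s(4, 5), s(5, 6), s(0, 7)]
  loopless := by decide

/-- The diagram `Ẽ₈`: arms of length `5`, `2`, `1`. -/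
def affineE8 : Multigraph where
  Vert := Fin 9
  Edge := Fin 8
  ends := ![s(0, 1), s(1, 2), s(2, 3), s(3, 4), s(4, 5), s(0, 6), s(6, 7), s(0, 8)]
  loopless := by decide

/-- `Γ` is of type `Ã_n` for some `n ≥ 1`. -/
def IsAffineTypeA (Γ : Multigraph) : Prop :=
  ∃ (n : ℕ) (hn : 1 ≤ n), Nonempty (Γ.Iso (affineA n hn))

/-- `Γ` is an affine (simply laced) Dynkin diagram. -/
def IsAffineDynkin (Γ : Multigraph) : Prop :=
  IsAffineTypeA Γ ∨ (∃ (n : ℕ) (hn : 4 ≤ n), Nonempty (Γ.Iso (affineD n hn))) ∨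
    Nonempty (Γ.Iso affineE6) ∨ Nonempty (Γ.Iso affineE7) ∨ Nonempty (Γ.Iso affineE8)

/-! ### Projective covers, socles and Nakayama translates over a ring -/

/-- `f : P → M` is a projective cover: `P` is projective, `f` is onto and its kernel is
superfluous. -/
def IsProjectiveCover {R P M : Type*} [Ring R] [AddCommGroup P] [Module R P] [AddCommGroup M]
    [Module R M] (f : P →ₗ[R] M) : Prop :=
  Module.Projective R P ∧ Function.Surjective f ∧
    ∀ N : Submodule R P, N ⊔ LinearMap.ker f = ⊤ → N = ⊤

/-- The socle of a module: the sum of its simple submodules. -/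
def moduleSocle (R M : Type*) [Ring R] [AddCommGroup M] [Module R M] : Submodule R M :=
  sSup {N : Submodule R M | IsSimpleModule R N}

/-- For simple left `R`-modules `S` and `T`: `T` is isomorphic to the socle of the projective
cover of `S`, that is, the Nakayama translation takes the class of `S` to that of `T`. -/
def IsNakayamaTranslate (R S T : Type) [Ring R] [AddCommGroup S] [Module R S]
    [AddCommGroup T] [Module R T] : Prop :=
  ∃ (P : Type) (_ : AddCommGroup P) (_ : Module R P) (f : P →ₗ[R] S),
    IsProjectiveCover f ∧ Nonempty (moduleSocle R P ≃ₗ[R] T)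

/-! ### The skew group algebra of the exterior algebra -/

section Skew

variable {G V : Type} [Group G] [AddCommGroup V] [Module ℂ V]

/-- The exterior algebra `⋀V` of the space of a representation of `G`. -/
def RepExterior (_ρ : Representation ℂ G V) : Type := ExteriorAlgebra ℂ V

instance (ρ : Representation ℂ G V) : Ring (RepExterior ρ) :=
  inferInstanceAs (Ring (ExteriorAlgebra ℂ V))

instance (ρ : Representation ℂ G V) : Algebra ℂ (RepExterior ρ) :=
  inferInstanceAs (Algebra ℂ (ExteriorAlgebra ℂ V))

/-- `G` acts on `⋀V` by algebra automorphisms, extending its action on `V`. -/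
instance (ρ : Representation ℂ G V) : MulSemiringAction G (RepExterior ρ) where
  smul g x := (ExteriorAlgebra.map (ρ g) : ExteriorAlgebra ℂ V →ₐ[ℂ] ExteriorAlgebra ℂ V) x
  one_smul x := by
    change ExteriorAlgebra.map (ρ 1) x = x
    rw [map_one]
    exact congrArg (fun φ => φ x) (ExteriorAlgebra.map_id (R := ℂ) (M := V))
  mul_smul g h x := by
    change ExteriorAlgebra.map (ρ (g * h)) x
      = ExteriorAlgebra.map (ρ g) (ExteriorAlgebra.map (ρ h) x)
    rw [map_mul]
    exact (congrArg (fun φ => φ x) (ExteriorAlgebra.map_comp_map (ρ h) (ρ g))).symm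
  smul_zero g := map_zero (ExteriorAlgebra.map (ρ g))
  smul_add g := map_add (ExteriorAlgebra.map (ρ g))
  smul_one g := map_one (ExteriorAlgebra.map (ρ g))
  smul_mul g := map_mul (ExteriorAlgebra.map (ρ g))

/-- The projection of `⋀V` onto its degree zero part `ℂ`. -/
def RepExterior.augmentation (ρ : Representation ℂ G V) : RepExterior ρ →ₐ[ℂ] ℂ :=
  (ExteriorAlgebra.algebraMapInv : ExteriorAlgebra ℂ V →ₐ[ℂ] ℂ)

theorem RepExterior.augmentation_smul (ρ : Representation ℂ G V) (g : G) (x : RepExterior ρ) :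
    RepExterior.augmentation ρ (g • x) = RepExterior.augmentation ρ x := by
  have h : (ExteriorAlgebra.algebraMapInv (R := ℂ) (M := V)).comp (ExteriorAlgebra.map (ρ g))
      = ExteriorAlgebra.algebraMapInv := by
    ext v
    simp [ExteriorAlgebra.algebraMapInv]
  exact congrArg (fun φ => φ x) h

/-- The skew group algebra `⋀V * G`. -/
abbrev SkewGroupAlgebra (ρ : Representation ℂ G V) : Type :=
  SkewMonoidAlgebra (RepExterior ρ) G

/-- The ring homomorphism `⋀V * G → ℂ G → End S` for a representation `S` of `G`: the element
`x g` acts as the degree zero part of `x` times `g`. -/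
def inflationHom (ρ : Representation ℂ G V) {S : Type} [AddCommGroup S] [Module ℂ S]
    (τ : Representation ℂ G S) : SkewGroupAlgebra ρ →+* Module.End ℂ S :=
  SkewMonoidAlgebra.liftNCRingHom
    ((algebraMap ℂ (Module.End ℂ S)).comp (RepExterior.augmentation ρ).toRingHom) τ
    (by
      intro x y
      have h := RepExterior.augmentation_smul ρ y x
      change algebraMap ℂ (Module.End ℂ S) (RepExterior.augmentation ρ (y • x)) * τ y
        = τ y * algebraMap ℂ (Module.End ℂ S) (RepExterior.augmentation ρ x)
      rw [h]
      exact Algebra.commutes _ _)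

/-- A representation `S` of `G`, seen as a module over `⋀V * G` on which `V` acts as zero. -/
def Inflation (_ρ : Representation ℂ G V) {S : Type} [AddCommGroup S] [Module ℂ S]
    (_τ : Representation ℂ G S) : Type := S

instance (ρ : Representation ℂ G V) {S : Type} [AddCommGroup S] [Module ℂ S]
    (τ : Representation ℂ G S) : AddCommGroup (Inflation ρ τ) :=
  inferInstanceAs (AddCommGroup S)

instance (ρ : Representation ℂ G V) {S : Type} [AddCommGroup S] [Module ℂ S]
    (τ : Representation ℂ G S) : Module (SkewGroupAlgebra ρ) (Inflation ρ τ) :=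
  Module.compHom S (inflationHom ρ τ)

end Skew

/-! ### McKay quivers -/

/-- An irreducible complex representation of `G`. -/
structure IrrRep (G : Type) [Group G] where
  carrier : Type
  [addCommGroup : AddCommGroup carrier]
  [module : Module ℂ carrier]
  rep : Representation ℂ G carrier
  irreducible : rep.IsIrreducible

attribute [instance] IrrRep.addCommGroup IrrRep.module

/-- Isomorphism of irreducible representations. -/
instance IrrRep.setoid (G : Type) [Group G] : Setoid (IrrRep G) where
  r S T := Nonempty (S.rep.Equiv T.rep)
  iseqv :=
    { refl := fun S => ⟨Representation.Equiv.refl S.rep⟩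
      symm := fun ⟨e⟩ => ⟨e.symm⟩
      trans := fun ⟨e⟩ ⟨f⟩ => ⟨e.trans f⟩ }

/-- The isomorphism classes of irreducible representations of `G`. -/
def IrrClass (G : Type) [Group G] : Type 1 := Quotient (IrrRep.setoid G)

/-- A chosen representative of a class. -/
def IrrClass.out {G : Type} [Group G] (i : IrrClass G) : IrrRep G := Quotient.out i

section McKay

variable {G V : Type} [Group G] [AddCommGroup V] [Module ℂ V]

/-- The multiplicity `a_{i,j}` of `S_j` in `V ⊗ S_i`, that is, the dimension of
`Hom_G (S_j, V ⊗ S_i)`. -/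
def mcKayMultiplicity (ρ : Representation ℂ G V) (i j : IrrClass G) : ℕ :=
  Module.finrank ℂ (Representation.IntertwiningMap j.out.rep (ρ.tprod i.out.rep))

/-- The vertices of the McKay quiver of `(G, V)`. -/
def McKayQuiver (_ρ : Representation ℂ G V) : Type 1 := IrrClass G

/-- The McKay quiver: `a_{i,j}` arrows from `i` to `j`. -/
instance (ρ : Representation ℂ G V) : Quiver (McKayQuiver ρ) where
  Hom i j := Fin (mcKayMultiplicity ρ i j)

/-- `j = σ i` for the Nakayama translation `σ` of the McKay quiver of `(G, V)`:
`S_j` is the socle of the projective cover of `S_i` over `⋀V * G`. -/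
def IsMcKayNakayama (ρ : Representation ℂ G V) (i j : IrrClass G) : Prop :=
  IsNakayamaTranslate (SkewGroupAlgebra ρ) (Inflation ρ i.out.rep) (Inflation ρ j.out.rep)

/-- The vertices of the quiver obtained from the McKay quiver of `(G, V)` by replacing the
Nakayama translation with arrows. -/
def NakayamaReplacedQuiver (_ρ : Representation ℂ G V) : Type 1 := IrrClass G

/-- The McKay quiver of `(G, V)` with one arrow from `σ i` to `i` added for each vertex `i`. -/
instance (ρ : Representation ℂ G V) : Quiver (NakayamaReplacedQuiver ρ) where
  Hom i j := Fin (mcKayMultiplicity ρ i j) ⊕ PLift (IsMcKayNakayama ρ j i)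

end McKay

/-! ### Subgroups of `ℂ*` and of `SL(2, ℂ)` -/

/-- The natural one-dimensional representation of a subgroup of `ℂ* = GL(1, ℂ)`. -/
def natRepUnits (G : Subgroup ℂˣ) : Representation ℂ G ℂ :=
  Representation.ofDistribMulAction ℂ G ℂ

/-- The natural representation on `ℂ²` of a subgroup of `SL(2, ℂ)`. -/
def natRepSL2 (G : Subgroup (Matrix.SpecialLinearGroup (Fin 2) ℂ)) :
    Representation ℂ G (Fin 2 → ℂ) where
  toFun g := Matrix.toLin' (g : Matrix.SpecialLinearGroup (Fin 2) ℂ).1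
  map_one' := by simp [Module.End.one_eq_id]
  map_mul' g h := by simp [Matrix.toLin'_mul, Module.End.mul_eq_comp]

/-- The embedding `ℂ* = GL(1, ℂ) → SL(2, ℂ)`, `z ↦ diag(z, z⁻¹)`. -/
def unitsToSL2 : ℂˣ →* Matrix.SpecialLinearGroup (Fin 2) ℂ where
  toFun z := ⟨!![(z : ℂ), 0; 0, ((z⁻¹ : ℂˣ) : ℂ)], by
    rw [Matrix.det_fin_two_of, Units.mul_inv]
    ring⟩
  map_one' := by
    apply Subtype.ext
    change !![((1 : ℂˣ) : ℂ), 0; 0, ((1⁻¹ : ℂˣ) : ℂ)] = 1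
    rw [Matrix.one_fin_two, inv_one, Units.val_one]
  map_mul' z w := by
    apply Subtype.ext
    change !![((z * w : ℂˣ) : ℂ), 0; 0, (((z * w)⁻¹ : ℂˣ) : ℂ)]
      = !![(z : ℂ), 0; 0, ((z⁻¹ : ℂˣ) : ℂ)] * !![(w : ℂ), 0; 0, ((w⁻¹ : ℂˣ) : ℂ)]
    rw [Matrix.mul_fin_two, mul_inv, Units.val_mul, Units.val_mul]
    ring_nf

end

/-! For a finite subgroup `G` of `ℂ*` the irreducible representations are the characters `χ : G →*
ℂˣ`, and the natural representation has the inclusion character `l`. Tensoring with it sends `χ` to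
`l * χ`, so the McKay quiver has exactly one arrow `χ ⟶ l * χ` at each vertex. As `V` is a line,
`⋀V` is the sum of its degree zero and degree one parts. Twisted by `χ`, it is the projective cover
of the simple module of `χ`, and its socle is the degree one part, on which `G` acts by `l * χ`.
Hence `σ χ = l * χ` (`isNakayamaTranslate_iff`), and the added arrows are exactly the reverses `l *
χ ⟶ χ`.

The new quiver is therefore the orbit quiver of multiplication by `l` (`nakayamaReplacedIso`). The
diagonal subgroup of `SL(2, ℂ)` acts on `ℂ²` with characters `l` and `l⁻¹`, and an arrow `χ ⟶ l⁻¹ *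
χ` is again a reversed one, so its McKay quiver is the same orbit quiver
(`nakayamaReplacedMcKayIso`). This gives the last assertion.

For `G` the group of `(n + 1)`-th roots of unity the characters are the powers of `l`, and the orbit
quiver is the double of `Ã_n` (`affineAReplacedIso`). Conversely every vertex of an orbit quiver of
a permutation emits two distinct arrows, whereas `D̃` and `Ẽ` have a leaf, which emits only one
(`isEmpty_quiverIso_of_leaf`). -/

noncomputable section


/-! ### Projective covers and socles -/

section Covers

variable {R P Q M : Type*} [Ring R] [AddCommGroup P] [Module R P] [AddCommGroup Q] [Module R Q]
  [AddCommGroup M] [Module R M]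

/-- Projective covers of a module are unique up to isomorphism. -/
theorem IsProjectiveCover.nonempty_linearEquiv {f : P →ₗ[R] M} {g : Q →ₗ[R] M}
    (hf : IsProjectiveCover f) (hg : IsProjectiveCover g) : Nonempty (P ≃ₗ[R] Q) := by
  obtain ⟨hP, hfs, hfk⟩ := hf
  obtain ⟨hQ, hgs, hgk⟩ := hg
  obtain ⟨h, hh⟩ := Module.projective_lifting_property g f hgs
  -- Since `g ∘ h = f` is onto, the range of `h` and the kernel of `g` span `Q`; superfluity of the
  -- kernel does the rest.
  have hsurj : Function.Surjective h := by
    rw [← LinearMap.range_eq_top]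
    refine hgk _ (eq_top_iff.2 fun q _ => ?_)
    obtain ⟨p, hp⟩ := hfs (g q)
    rw [← sub_add_cancel q (h p), add_comm]
    refine Submodule.add_mem_sup ⟨p, rfl⟩ ?_
    rw [LinearMap.mem_ker, map_sub, ← hp, ← hh, LinearMap.comp_apply, sub_self]
  obtain ⟨s, hs⟩ := Module.projective_lifting_property h LinearMap.id hsurj
  have hs' : ∀ q, h (s q) = q := fun q => LinearMap.congr_fun hs q
  -- The same argument for the section `s`, now with the superfluous kernel of `f`. A section that
  -- is onto makes `h` injective.
  have hssurj : Function.Surjective s := by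
    rw [← LinearMap.range_eq_top]
    refine hfk _ (eq_top_iff.2 fun p _ => ?_)
    rw [← sub_add_cancel p (s (h p)), add_comm]
    refine Submodule.add_mem_sup ⟨h p, rfl⟩ ?_
    rw [LinearMap.mem_ker, ← hh, LinearMap.comp_apply, map_sub, hs', sub_self, map_zero]
  refine ⟨LinearEquiv.ofBijective h ⟨fun a b hab => ?_, hsurj⟩⟩
  obtain ⟨a, rfl⟩ := hssurj a
  obtain ⟨b, rfl⟩ := hssurj b
  rw [hs', hs'] at hab
  rw [hab]

/-- An isomorphism of modules maps the socle onto the socle. -/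
theorem moduleSocle_map (e : P ≃ₗ[R] Q) :
    (moduleSocle R P).map e.toLinearMap = moduleSocle R Q := by
  have h := (Submodule.orderIsoMapComap e).map_sSup {N : Submodule R P | IsSimpleModule R N}
  refine h.trans ?_
  rw [moduleSocle, sSup_eq_iSup]
  refine le_antisymm (iSup₂_le fun N hN => ?_) (iSup₂_le fun N hN => ?_)
  · refine le_iSup₂_of_le (Submodule.orderIsoMapComap e N) ?_ le_rfl
    simp only [Set.mem_ofPred_eq, isSimpleModule_iff_isAtom] at hN ⊢
    exact (OrderIso.isAtom_iff (Submodule.orderIsoMapComap e) N).2 hN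
  · refine le_iSup₂_of_le ((Submodule.orderIsoMapComap e).symm N) ?_ ?_
    · simp only [Set.mem_ofPred_eq, isSimpleModule_iff_isAtom] at hN ⊢
      exact (OrderIso.isAtom_iff (Submodule.orderIsoMapComap e).symm N).2 hN
    · rw [OrderIso.apply_symm_apply]

/-- Isomorphic modules have isomorphic socles. -/
def moduleSocleEquiv (e : P ≃ₗ[R] Q) : moduleSocle R P ≃ₗ[R] moduleSocle R Q :=
  (e.submoduleMap _).trans (LinearEquiv.ofEq _ _ (moduleSocle_map e))

/-- A least nonzero submodule is the socle. -/
theorem moduleSocle_eq_of_le {L : Submodule R P} (hL : L ≠ ⊥) (h : ∀ N ≠ ⊥, L ≤ N) :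
    moduleSocle R P = L := by
  have hatom : IsAtom L := ⟨hL, fun N hN => by
    by_contra hne
    exact hN.not_ge (h N hne)⟩
  refine le_antisymm (sSup_le fun N hN => ?_) (le_sSup ((isSimpleModule_iff_isAtom).2 hatom))
  have hN' : IsAtom N := (isSimpleModule_iff_isAtom).1 hN
  exact ((hN'.le_iff.1 (h N hN'.1)).resolve_left hL).ge

end Covers

/-! ### The projective cover of a character over the skew group algebra -/

/-- A representation is one dimensional, with the given character. -/
structure Representation.Affords {G S : Type*} [Group G] [AddCommGroup S] [Module ℂ S]
    (τ : Representation ℂ G S) (χ : G →* ℂˣ) : Prop where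
  finrank_eq_one : Module.finrank ℂ S = 1
  apply_eq : ∀ g v, τ g v = (χ g : ℂ) • v

theorem Representation.Affords.exists_ne_zero {G S : Type*} [Group G]
    [AddCommGroup S] [Module ℂ S]
    {τ : Representation ℂ G S} {χ : G →* ℂˣ} (h : τ.Affords χ) : ∃ s : S, s ≠ 0 := by
  have := Module.nontrivial_of_finrank_pos (R := ℂ) (M := S) (h.finrank_eq_one.symm ▸ Nat.one_pos)
  exact exists_ne 0

section Skew

variable {G V : Type} [Group G] [AddCommGroup V] [Module ℂ V]

theorem RepExterior.smul_algebraMap (ρ : Representation ℂ G V) (g : G) (c : ℂ) :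
    g • algebraMap ℂ (RepExterior ρ) c = algebraMap ℂ (RepExterior ρ) c :=
  (ExteriorAlgebra.map (ρ g)).commutes c

/-- The exterior algebra `⋀V` with the action of `⋀V * G` in which `g` acts by its natural action
multiplied by `χ g`. -/
def TwistedExterior (ρ : Representation ℂ G V) (_χ : G →* ℂˣ) : Type := RepExterior ρ

instance (ρ : Representation ℂ G V) (χ : G →* ℂˣ) : AddCommGroup (TwistedExterior ρ χ) :=
  inferInstanceAs (AddCommGroup (RepExterior ρ))

/-- The action of `G` on `⋀V`, multiplied by the character `χ`. -/
def twistedAction (ρ : Representation ℂ G V) (χ : G →* ℂˣ) : G →* AddMonoid.End (RepExterior ρ) where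
  toFun g := (AddMonoidHom.mulLeft (algebraMap ℂ (RepExterior ρ) (χ g))).comp
    (DistribSMul.toAddMonoidHom (RepExterior ρ) g)
  map_one' := by
    ext x
    change algebraMap ℂ (RepExterior ρ) ((χ 1 : ℂˣ) : ℂ) * ((1 : G) • x) = x
    rw [map_one, Units.val_one, map_one, one_mul, one_smul]
  map_mul' g h := by
    ext x
    change algebraMap ℂ (RepExterior ρ) (χ (g * h)) * ((g * h) • x)
      = algebraMap ℂ (RepExterior ρ) (χ g) *
        (g • (algebraMap ℂ (RepExterior ρ) (χ h) * (h • x)))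
    rw [smul_mul', RepExterior.smul_algebraMap, map_mul, Units.val_mul, map_mul, mul_smul, mul_assoc]

/-- The ring homomorphism defining the module structure of `TwistedExterior`. -/
def twistedHom (ρ : Representation ℂ G V) (χ : G →* ℂˣ) :
    SkewGroupAlgebra ρ →+* AddMonoid.End (RepExterior ρ) :=
  SkewMonoidAlgebra.liftNCRingHom (Module.toAddMonoidEnd (RepExterior ρ) (RepExterior ρ))
    (twistedAction ρ χ) (by
      intro x g
      ext p
      change g • x * (algebraMap ℂ (RepExterior ρ) (χ g) * (g • p))
        = algebraMap ℂ (RepExterior ρ) (χ g) * (g • (x * p))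
      rw [smul_mul', ← mul_assoc, ← mul_assoc, Algebra.commutes])

instance (ρ : Representation ℂ G V) (χ : G →* ℂˣ) :
    Module (SkewGroupAlgebra ρ) (TwistedExterior ρ χ) :=
  Module.compHom (RepExterior ρ) (twistedHom ρ χ)

theorem TwistedExterior.single_smul (ρ : Representation ℂ G V) (χ : G →* ℂˣ) (g : G)
    (r p : RepExterior ρ) :
    (SkewMonoidAlgebra.single g r • (show TwistedExterior ρ χ from p) : TwistedExterior ρ χ)
      = r * (algebraMap ℂ (RepExterior ρ) (χ g) * (g • p)) :=
  DFunLike.congr_fun (SkewMonoidAlgebra.liftNC_single _ _ _ _) p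

theorem Inflation.single_smul (ρ : Representation ℂ G V) {S : Type} [AddCommGroup S] [Module ℂ S]
    (τ : Representation ℂ G S) (g : G) (r : RepExterior ρ) (s : S) :
    (SkewMonoidAlgebra.single g r • (show Inflation ρ τ from s) : Inflation ρ τ)
      = RepExterior.augmentation ρ r • τ g s :=
  DFunLike.congr_fun (SkewMonoidAlgebra.liftNC_single _ _ _ _) s

/-- An additive map commuting with the elements `r g` of `⋀V * G` is linear. -/
def SkewGroupAlgebra.linearMapMk (ρ : Representation ℂ G V) {M N : Type*} [AddCommGroup M]
    [Module (SkewGroupAlgebra ρ) M] [AddCommGroup N] [Module (SkewGroupAlgebra ρ) N]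
    (f : M →+ N)
    (hf : ∀ (g : G) (r : RepExterior ρ) (m : M), f ((SkewMonoidAlgebra.single g r : SkewGroupAlgebra ρ) • m)
      = (SkewMonoidAlgebra.single g r : SkewGroupAlgebra ρ) • f m) :
    M →ₗ[SkewGroupAlgebra ρ] N where
  toFun := f
  map_add' := f.map_add
  map_smul' a m := by
    rw [RingHom.id_apply]
    induction a using SkewMonoidAlgebra.induction_on with
    | zero => rw [zero_smul, zero_smul, map_zero]
    | single g r => exact hf g r m
    | add a b ha hb => rw [add_smul, add_smul, map_add, ha, hb]

section Idempotent

variable [Fintype G]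

/-- The idempotent of `⋀V * G` attached to a character of `G`. -/
def characterIdempotent (ρ : Representation ℂ G V) (χ : G →* ℂˣ) : SkewGroupAlgebra ρ :=
  ∑ g : G, SkewMonoidAlgebra.single g
    (algebraMap ℂ (RepExterior ρ) ((Fintype.card G : ℂ)⁻¹ * ((χ g)⁻¹ : ℂˣ)))

/-- Reindexing the sum by `g ↦ h * g` shows that the idempotent absorbs `h` at the cost of the
scalar `χ h`. -/
theorem single_mul_characterIdempotent (ρ : Representation ℂ G V) (χ : G →* ℂˣ) (h : G)
    (r : RepExterior ρ) :
    SkewMonoidAlgebra.single h r * characterIdempotent ρ χ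
      = SkewMonoidAlgebra.single 1 (r * algebraMap ℂ (RepExterior ρ) (χ h)) *
        characterIdempotent ρ χ := by
  rw [characterIdempotent, Finset.mul_sum, Finset.mul_sum]
  refine Fintype.sum_equiv (Equiv.mulLeft h) _ _ fun g => ?_
  rw [SkewMonoidAlgebra.single_mul_single, SkewMonoidAlgebra.single_mul_single, one_mul, one_smul,
    RepExterior.smul_algebraMap, Equiv.coe_mulLeft, mul_assoc, ← map_mul]
  congr 3
  rw [map_mul, mul_inv, Units.val_mul, mul_left_comm, ← mul_assoc (χ h : ℂ), Units.mul_inv, one_mul]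

theorem characterIdempotent_smul_one (ρ : Representation ℂ G V) (χ : G →* ℂˣ) :
    characterIdempotent ρ χ • (show TwistedExterior ρ χ from (1 : RepExterior ρ))
      = (1 : RepExterior ρ) := by
  rw [characterIdempotent, Finset.sum_smul]
  have h : ∀ g : G, (SkewMonoidAlgebra.single g
      (algebraMap ℂ (RepExterior ρ) ((Fintype.card G : ℂ)⁻¹ * ((χ g)⁻¹ : ℂˣ))) •
        (show TwistedExterior ρ χ from (1 : RepExterior ρ)) : TwistedExterior ρ χ)
      = algebraMap ℂ (RepExterior ρ) (Fintype.card G : ℂ)⁻¹ := fun g => by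
    refine (TwistedExterior.single_smul ρ χ g _ _).trans ?_
    rw [smul_one, mul_one, ← map_mul, mul_assoc, Units.inv_mul, mul_one]
  rw [Finset.sum_congr rfl fun g _ => h g]
  refine (Finset.sum_const (algebraMap ℂ (RepExterior ρ) (Fintype.card G : ℂ)⁻¹)).trans ?_
  rw [← map_nsmul, Finset.card_univ, nsmul_eq_mul,
    mul_inv_cancel₀ (Nat.cast_ne_zero.2 Fintype.card_ne_zero), map_one]

end Idempotent

/-- The module is a direct summand of the regular module: `p ↦ p * e`, with `e` the idempotent of
`χ`, is linear and is split by `a ↦ a • 1`, because `e • 1 = 1`. -/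
instance [Finite G] (ρ : Representation ℂ G V) (χ : G →* ℂˣ) :
    Module.Projective (SkewGroupAlgebra ρ) (TwistedExterior ρ χ) := by
  have := Fintype.ofFinite G
  refine Module.Projective.of_split (R := SkewGroupAlgebra ρ)
    (M := SkewGroupAlgebra ρ)
    (SkewGroupAlgebra.linearMapMk ρ (M := TwistedExterior ρ χ)
      ((AddMonoidHom.mulRight (characterIdempotent ρ χ)).comp
        (SkewMonoidAlgebra.singleAddHom (1 : G))) fun g r (p : RepExterior ρ) => ?_)
    (LinearMap.toSpanSingleton (SkewGroupAlgebra ρ) (TwistedExterior ρ χ) (1 : RepExterior ρ))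
    (LinearMap.ext fun (p : RepExterior ρ) => ?_)
  · refine (congrArg (fun q : RepExterior ρ => (SkewMonoidAlgebra.single 1 q : SkewGroupAlgebra ρ) *
      characterIdempotent ρ χ) (TwistedExterior.single_smul ρ χ g r p)).trans ?_
    change _ = SkewMonoidAlgebra.single g r *
      (SkewMonoidAlgebra.single 1 p * characterIdempotent ρ χ)
    rw [← mul_assoc (SkewMonoidAlgebra.single g r), SkewMonoidAlgebra.single_mul_single, mul_one,
      single_mul_characterIdempotent ρ χ g, Algebra.commutes (χ g : ℂ) (g • p), mul_assoc r]
  · refine (mul_smul (SkewMonoidAlgebra.single 1 p) (characterIdempotent ρ χ)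
      (show TwistedExterior ρ χ from (1 : RepExterior ρ))).trans ?_
    refine (congrArg (fun q : TwistedExterior ρ χ => (SkewMonoidAlgebra.single 1 p :
      SkewGroupAlgebra ρ) • q) (characterIdempotent_smul_one ρ χ)).trans ?_
    refine (TwistedExterior.single_smul ρ χ 1 p _).trans ?_
    rw [map_one, Units.val_one, map_one, one_smul, one_mul, mul_one]
    rfl

/-- The projection of the twisted exterior algebra onto its degree zero part. -/
def TwistedExterior.proj (ρ : Representation ℂ G V) (χ : G →* ℂˣ) {S : Type} [AddCommGroup S]
    [Module ℂ S] {τ : Representation ℂ G S} (hτ : τ.Affords χ) (s : S) :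
    TwistedExterior ρ χ →ₗ[SkewGroupAlgebra ρ] Inflation ρ τ :=
  SkewGroupAlgebra.linearMapMk ρ
    (((LinearMap.toSpanSingleton ℂ S s).comp
      (RepExterior.augmentation ρ).toLinearMap).toAddMonoidHom) fun g r (p : RepExterior ρ) => by
    refine Eq.trans ?_ (Inflation.single_smul ρ τ g r _).symm
    refine (congrArg (fun q : RepExterior ρ => RepExterior.augmentation ρ q • s)
      (TwistedExterior.single_smul ρ χ g r p)).trans ?_
    change _ = RepExterior.augmentation ρ r •
      τ g (RepExterior.augmentation ρ p • s)
    rw [hτ.apply_eq, map_mul, map_mul, RepExterior.augmentation_smul,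
      AlgHom.commutes, mul_smul, mul_smul]
    rfl

end Skew


/-! ### The Nakayama translation of a one dimensional representation -/

section Line

variable {G : Type} [Group G]

/-- The degree one elements of the exterior algebra. -/
def RepExterior.vec {V : Type} [AddCommGroup V] [Module ℂ V] (ρ : Representation ℂ G V) :
    V →ₗ[ℂ] RepExterior ρ :=
  ExteriorAlgebra.ι ℂ

theorem RepExterior.augmentation_vec {V : Type} [AddCommGroup V] [Module ℂ V]
    (ρ : Representation ℂ G V) (v : V) :
    RepExterior.augmentation ρ (RepExterior.vec ρ v) = 0 := by
  change ExteriorAlgebra.algebraMapInv (ExteriorAlgebra.ι ℂ v) = 0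
  simp [ExteriorAlgebra.algebraMapInv]

variable (ρ : Representation ℂ G ℂ)

theorem RepExterior.vec_mul_vec (b c : ℂ) :
    RepExterior.vec ρ b * RepExterior.vec ρ c = 0 := by
  have h := ExteriorAlgebra.ι_sq_zero (R := ℂ) (1 : ℂ)
  have hb : ∀ b : ℂ, RepExterior.vec ρ b = b • RepExterior.vec ρ 1 := fun b => by
    rw [← map_smul, smul_eq_mul, mul_one]
  rw [hb b, hb c, smul_mul_smul_comm]
  exact (congrArg ((b * c) • ·) h).trans (smul_zero (A := ExteriorAlgebra ℂ ℂ) (b * c))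

/-- Sums of a scalar and a vector are closed under products because two vectors of a line multiply
to zero; so they exhaust the exterior algebra. -/
theorem RepExterior.exists_eq (x : RepExterior ρ) :
    ∃ b, x = algebraMap ℂ (RepExterior ρ) (RepExterior.augmentation ρ x) + RepExterior.vec ρ b := by
  suffices h : ∃ a b, x = algebraMap ℂ (RepExterior ρ) a + RepExterior.vec ρ b by
    obtain ⟨a, b, rfl⟩ := h
    refine ⟨b, ?_⟩
    rw [map_add, AlgHom.commutes, RepExterior.augmentation_vec]
    simp
  refine ExteriorAlgebra.induction (R := ℂ) (M := ℂ) (C := fun x => ∃ a b,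
    (show RepExterior ρ from x) = algebraMap ℂ (RepExterior ρ) a + RepExterior.vec ρ b)
    (fun r => ⟨r, 0, ?_⟩) (fun v => ⟨0, v, ?_⟩) ?_ ?_ x
  · rw [map_zero, add_zero]
    rfl
  · rw [map_zero, zero_add]
    rfl
  · rintro (x : RepExterior ρ) (y : RepExterior ρ) ⟨a, b, hx⟩ ⟨c, d, hy⟩
    refine ⟨a * c, a * d + c * b, ?_⟩
    change x * y = _
    change x = _ at hx
    change y = _ at hy
    rw [hx, hy, add_mul, mul_add, mul_add, RepExterior.vec_mul_vec, ← map_mul, ← Algebra.smul_def,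
      ← Algebra.commutes, ← Algebra.smul_def, ← map_smul, ← map_smul, map_add, add_zero, add_assoc]
    rfl
  · rintro (x : RepExterior ρ) (y : RepExterior ρ) ⟨a, b, hx⟩ ⟨c, d, hy⟩
    refine ⟨a + c, b + d, ?_⟩
    change x + y = _
    change x = _ at hx
    change y = _ at hy
    rw [hx, hy, map_add, map_add, add_add_add_comm]

theorem RepExterior.mul_vec (x : RepExterior ρ) (b : ℂ) :
    x * RepExterior.vec ρ b = RepExterior.vec ρ (RepExterior.augmentation ρ x * b) := by
  obtain ⟨c, hc⟩ := RepExterior.exists_eq ρ x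
  conv_lhs => rw [hc]
  rw [add_mul, RepExterior.vec_mul_vec, add_zero, ← Algebra.smul_def, ← map_smul, smul_eq_mul]

theorem RepExterior.vec_injective {V : Type} [AddCommGroup V] [Module ℂ V]
    (ρ : Representation ℂ G V) : Function.Injective (RepExterior.vec ρ) :=
  ExteriorAlgebra.ι_leftInverse.injective

theorem RepExterior.smul_vec {V : Type} [AddCommGroup V] [Module ℂ V]
    (ρ : Representation ℂ G V) (g : G) (v : V) :
    g • RepExterior.vec ρ v = RepExterior.vec ρ (ρ g v) :=
  ExteriorAlgebra.map_apply_ι (ρ g) v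

variable {ρ} {l χ : G →* ℂˣ} {S : Type} [AddCommGroup S] [Module ℂ S] {τ : Representation ℂ G S}

/-- The factor `l g` comes from the action on `V`, the factor `χ g` from the twist. This is the
source of the formula `σ χ = l * χ`. -/
theorem TwistedExterior.single_smul_vec (hρ : ρ.Affords l) (g : G) (r : RepExterior ρ) (b : ℂ) :
    (SkewMonoidAlgebra.single g r • (show TwistedExterior ρ χ from RepExterior.vec ρ b) :
      TwistedExterior ρ χ)
      = RepExterior.vec ρ (RepExterior.augmentation ρ r * ((l * χ) g * b)) := by
  refine (TwistedExterior.single_smul ρ χ g r _).trans ?_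
  rw [RepExterior.smul_vec, RepExterior.mul_vec, RepExterior.mul_vec, AlgHom.commutes,
    hρ.apply_eq]
  simp only [smul_eq_mul, MonoidHom.mul_apply, Units.val_mul, Algebra.algebraMap_self,
    RingHom.id_apply]
  congr 1
  ring

theorem TwistedExterior.mem_ker_proj (hτ : τ.Affords χ) {s : S} (hs : s ≠ 0)
    (p : RepExterior ρ) :
    (show TwistedExterior ρ χ from p) ∈ LinearMap.ker (TwistedExterior.proj ρ χ hτ s) ↔
      ∃ b, p = RepExterior.vec ρ b := by
  have h : (show TwistedExterior ρ χ from p) ∈ LinearMap.ker (TwistedExterior.proj ρ χ hτ s) ↔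
      RepExterior.augmentation ρ p = 0 := by
    change RepExterior.augmentation ρ p • s = 0 ↔ _
    rw [smul_eq_zero, or_iff_left hs]
  rw [h]
  constructor
  · intro h0
    obtain ⟨b, hb⟩ := RepExterior.exists_eq ρ p
    rw [h0, map_zero, zero_add] at hb
    exact ⟨b, hb⟩
  · rintro ⟨b, rfl⟩
    exact RepExterior.augmentation_vec ρ b

theorem TwistedExterior.vec_mem (hτ : τ.Affords χ) {s : S} (hs : s ≠ 0) (b : ℂ) :
    (show TwistedExterior ρ χ from RepExterior.vec ρ b) ∈
      LinearMap.ker (TwistedExterior.proj ρ χ hτ s) :=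
  (TwistedExterior.mem_ker_proj hτ hs _).2 ⟨b, rfl⟩

/-- The degree one part is contained in every nonzero submodule. -/
theorem TwistedExterior.ker_proj_le (hτ : τ.Affords χ) {s : S} (hs : s ≠ 0)
    (N : Submodule (SkewGroupAlgebra ρ) (TwistedExterior ρ χ)) (hN : N ≠ ⊥) :
    LinearMap.ker (TwistedExterior.proj ρ χ hτ s) ≤ N := by
  obtain ⟨(p : RepExterior ρ), hp, hp0⟩ := (Submodule.ne_bot_iff N).1 hN
  obtain ⟨c, hc⟩ := RepExterior.exists_eq ρ p
  rintro (q : RepExterior ρ) hq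
  obtain ⟨b, rfl⟩ := (TwistedExterior.mem_ker_proj hτ hs q).1 hq
  have key : ∀ r : RepExterior ρ, (show TwistedExterior ρ χ from r * p) ∈ N := fun r => by
    have := N.smul_mem (SkewMonoidAlgebra.single 1 r) hp
    have h1 := TwistedExterior.single_smul ρ χ 1 r p
    rw [map_one, Units.val_one, map_one, one_mul, one_smul] at h1
    exact h1 ▸ this
  by_cases ha : RepExterior.augmentation ρ p = 0
  -- Here `p` is a nonzero vector, and a scalar multiple of it reaches any other vector.
  · rw [ha, map_zero, zero_add] at hc
    have hc0 : c ≠ 0 := by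
      rintro rfl
      exact hp0 (hc.trans (map_zero _))
    have := key (algebraMap ℂ (RepExterior ρ) (b / c))
    rw [hc, RepExterior.mul_vec, AlgHom.commutes] at this
    rwa [show (algebraMap ℂ ℂ) (b / c) * c = b from div_mul_cancel₀ b hc0] at this
  -- Here `p` has scalar part `a ≠ 0`; multiplying by the vector `b / a` kills the degree one part
  -- of `p` and leaves the vector `b`.
  · generalize RepExterior.augmentation ρ p = a at hc ha
    have := key (RepExterior.vec ρ (b / a))
    rw [hc, mul_add, RepExterior.vec_mul_vec, add_zero, ← Algebra.commutes, ← Algebra.smul_def,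
      ← map_smul, smul_eq_mul, mul_div_cancel₀ b ha] at this
    exact this

theorem TwistedExterior.ker_proj_ne_bot (hτ : τ.Affords χ) {s : S} (hs : s ≠ 0) :
    LinearMap.ker (TwistedExterior.proj ρ χ hτ s) ≠ ⊥ := by
  refine (Submodule.ne_bot_iff _).2 ⟨_, TwistedExterior.vec_mem hτ hs 1, fun h => ?_⟩
  exact one_ne_zero (RepExterior.vec_injective ρ (h.trans (map_zero _).symm))

theorem TwistedExterior.isProjectiveCover_proj [Finite G] (hτ : τ.Affords χ) {s : S} (hs : s ≠ 0) :
    IsProjectiveCover (TwistedExterior.proj ρ χ hτ s) := by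
  have hsurj : Function.Surjective (TwistedExterior.proj ρ χ hτ s) := fun t => by
    obtain ⟨c, hc⟩ := (finrank_eq_one_iff_of_nonzero' s hs).1 hτ.finrank_eq_one t
    refine ⟨algebraMap ℂ (RepExterior ρ) c, ?_⟩
    change RepExterior.augmentation ρ (algebraMap ℂ (RepExterior ρ) c) • s = _
    rw [AlgHom.commutes]
    exact hc
  refine ⟨inferInstance, hsurj, fun N hN => ?_⟩
  -- The zero submodule cannot complement the kernel, the projection being nonzero; any other
  -- submodule already contains the kernel.
  have hN0 : N ≠ ⊥ := by
    rintro rfl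
    rw [bot_sup_eq, LinearMap.ker_eq_top] at hN
    obtain ⟨p, hp⟩ := hsurj s
    rw [hN] at hp
    exact hs hp.symm
  rwa [sup_eq_left.2 (TwistedExterior.ker_proj_le hτ hs N hN0)] at hN

/-- Over `⋀V * G` with `V` one dimensional with character `l`, the Nakayama translate of the simple
module with character `χ` is the one with character `l * χ`. -/
theorem isNakayamaTranslate_iff [Finite G] (hρ : ρ.Affords l) (hτ : τ.Affords χ)
    {T : Type} [AddCommGroup T] [Module ℂ T] {τ' : Representation ℂ G T} {χ' : G →* ℂˣ}
    (hτ' : τ'.Affords χ') :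
    IsNakayamaTranslate (SkewGroupAlgebra ρ) (Inflation ρ τ) (Inflation ρ τ') ↔ χ' = l * χ := by
  obtain ⟨s, hs⟩ := hτ.exists_ne_zero
  obtain ⟨t, ht⟩ := hτ'.exists_ne_zero
  have hsoc := moduleSocle_eq_of_le (TwistedExterior.ker_proj_ne_bot (ρ := ρ) hτ hs)
    (TwistedExterior.ker_proj_le hτ hs)
  constructor
  · rintro ⟨P, _, _, f, hf, ⟨e⟩⟩
    obtain ⟨e'⟩ := (TwistedExterior.isProjectiveCover_proj hτ hs).nonempty_linearEquiv hf
    let φ : LinearMap.ker (TwistedExterior.proj ρ χ hτ s) ≃ₗ[SkewGroupAlgebra ρ] Inflation ρ τ' :=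
      (LinearEquiv.ofEq _ _ hsoc.symm).trans ((moduleSocleEquiv e').trans e)
    ext g
    obtain ⟨⟨(p : RepExterior ρ), hp⟩, hpt⟩ := φ.surjective (show Inflation ρ τ' from t)
    obtain ⟨b, rfl⟩ := (TwistedExterior.mem_ker_proj hτ hs p).1 hp
    set q : LinearMap.ker (TwistedExterior.proj ρ χ hτ s) := ⟨RepExterior.vec ρ b, hp⟩
    -- On the socle `g` acts as the scalar `(l * χ) g`. Both sides are elements of the skew group
    -- algebra, so `φ` carries the identity to `t`, where `g` acts by `χ' g`.
    have h1 : (SkewMonoidAlgebra.single g (1 : RepExterior ρ) : SkewGroupAlgebra ρ) • q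
        = (SkewMonoidAlgebra.single (1 : G) (algebraMap ℂ (RepExterior ρ) ((l * χ) g)) :
          SkewGroupAlgebra ρ) • q := by
      apply Subtype.ext
      refine (TwistedExterior.single_smul_vec hρ g _ b).trans
        (Eq.trans ?_ (TwistedExterior.single_smul_vec hρ 1 _ b).symm)
      rw [AlgHom.commutes, map_one, map_one, Units.val_one, one_mul, one_mul]
      rfl
    have h2 := congrArg φ h1
    rw [map_smul, map_smul, hpt] at h2
    have h3 := (Inflation.single_smul ρ τ' g 1 t).symm.trans
      (h2.trans (Inflation.single_smul ρ τ' 1 _ t))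
    rw [map_one, one_smul, map_one, AlgHom.commutes, hτ'.apply_eq] at h3
    exact smul_left_injective ℂ ht h3
  · rintro rfl
    refine ⟨TwistedExterior ρ χ, inferInstance, inferInstance, TwistedExterior.proj ρ χ hτ s,
      TwistedExterior.isProjectiveCover_proj hτ hs, ?_⟩
    let e : ℂ ≃ₗ[ℂ] T := LinearEquiv.toSpanNonzeroSingleton ℂ T t ht |>.trans
      (LinearEquiv.ofTop _ ((finrank_eq_one_iff_of_nonzero t ht).1 hτ'.finrank_eq_one))
    let f : Inflation ρ τ' →ₗ[SkewGroupAlgebra ρ] TwistedExterior ρ χ :=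
      SkewGroupAlgebra.linearMapMk ρ
        (((RepExterior.vec ρ).comp e.symm.toLinearMap).toAddMonoidHom) fun g r (x : T) => by
        refine (congrArg (fun y : T => RepExterior.vec ρ (e.symm y))
          (Inflation.single_smul ρ τ' g r x)).trans ?_
        refine Eq.trans ?_ (TwistedExterior.single_smul_vec hρ g r (e.symm x)).symm
        rw [hτ'.apply_eq, smul_smul, map_smul, smul_eq_mul, mul_assoc]
    rw [hsoc]
    refine ⟨(LinearEquiv.ofBijective (f.codRestrict (LinearMap.ker (TwistedExterior.proj ρ χ hτ s))
      fun x => TwistedExterior.vec_mem hτ hs _) ⟨?_, ?_⟩).symm⟩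
    · intro x y hxy
      exact e.symm.injective (RepExterior.vec_injective ρ (congrArg Subtype.val hxy))
    · rintro ⟨(p : RepExterior ρ), hp⟩
      obtain ⟨b, rfl⟩ := (TwistedExterior.mem_ker_proj hτ hs p).1 hp
      refine ⟨e b, Subtype.ext ?_⟩
      exact congrArg (RepExterior.vec ρ) (e.symm_apply_apply b)

end Line


/-! ### Irreducible representations of finite commutative groups -/

section Irreducible

/-- The orbit of a nonzero vector is finite and spans a nonzero subrepresentation, which must be
everything. -/
theorem Representation.IsIrreducible.finiteDimensional {G S : Type*} [Group G] [Finite G]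
    [AddCommGroup S] [Module ℂ S] {τ : Representation ℂ G S} (h : τ.IsIrreducible) :
    FiniteDimensional ℂ S := by
  have hnt : Nontrivial S := by
    by_contra hS
    rw [not_nontrivial_iff_subsingleton] at hS
    exact bot_ne_top (α := Subrepresentation τ)
      (Subrepresentation.toSubmodule_injective (Subsingleton.elim _ _))
  obtain ⟨s, hs⟩ := exists_ne (0 : S)
  let W : Subrepresentation τ := ⟨Submodule.span ℂ (Set.range fun g => τ g s), fun g v hv => by
    have h1 := Submodule.mem_map_of_mem (f := τ g) hv
    rw [Submodule.map_span, ← Set.range_comp] at h1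
    refine Submodule.span_mono ?_ h1
    rintro _ ⟨h, rfl⟩
    exact ⟨g * h, by simp⟩⟩
  have hsW : s ∈ W.toSubmodule := Submodule.subset_span ⟨1, by simp⟩
  have hW : W = ⊤ := (h.eq_bot_or_eq_top W).resolve_left fun h0 => hs (by
    rw [h0] at hsW
    exact (Submodule.mem_bot ℂ).1 hsW)
  have hW' : Submodule.span ℂ (Set.range fun g => τ g s) = ⊤ :=
    congrArg Subrepresentation.toSubmodule hW
  exact ⟨hW' ▸ Submodule.fg_span (Set.finite_range _)⟩

variable {G : Type} [Group G] [IsMulCommutative G] [Finite G]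

theorem Representation.IsIrreducible.exists_affords {S : Type*}
    [AddCommGroup S] [Module ℂ S] {τ : Representation ℂ G S} (h : τ.IsIrreducible) :
    ∃ χ : G →* ℂˣ, τ.Affords χ := by
  have := h.finiteDimensional
  have h1 : Module.finrank ℂ S = 1 :=
    Representation.IsIrreducible.finrank_eq_one_of_isMulCommutative τ
  obtain ⟨s, hs⟩ := Module.finrank_pos_iff_exists_ne_zero.1 (h1 ▸ Nat.one_pos)
  have hspan := (finrank_eq_one_iff_of_nonzero' s hs).1 h1
  choose c hc using fun g => hspan (τ g s)
  have happ : ∀ g v, τ g v = c g • v := fun g v => by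
    obtain ⟨a, rfl⟩ := hspan v
    rw [map_smul, ← hc, smul_comm]
  let c' : G →* ℂ :=
    { toFun := c
      map_one' := smul_left_injective ℂ hs (by
        change c 1 • s = (1 : ℂ) • s
        rw [hc, map_one, one_smul]; rfl)
      map_mul' := fun g h => smul_left_injective ℂ hs (by
        change c (g * h) • s = (c g * c h) • s
        rw [hc, map_mul, Module.End.mul_apply, happ h, happ g, smul_smul]) }
  exact ⟨c'.toHomUnits, h1, happ⟩

theorem Representation.Affords.congr_equiv {G S T : Type*} [Group G] [AddCommGroup S] [Module ℂ S]
    [AddCommGroup T] [Module ℂ T] {τ : Representation ℂ G S} {τ' : Representation ℂ G T}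
    {χ χ' : G →* ℂˣ} (h : τ.Affords χ) (h' : τ'.Affords χ') :
    Nonempty (τ.Equiv τ') ↔ χ = χ' := by
  constructor
  · rintro ⟨e⟩
    obtain ⟨s, hs⟩ := h.exists_ne_zero
    ext g
    have h1 := Representation.IntertwiningMap.isIntertwining _ _ e.toIntertwiningMap g s
    rw [h.apply_eq, h'.apply_eq, map_smul] at h1
    refine smul_left_injective ℂ (fun h0 => hs ?_) h1
    exact e.toLinearEquiv.map_eq_zero_iff.1 h0
  · rintro rfl
    have := Module.finite_of_finrank_pos (h.finrank_eq_one.symm ▸ Nat.one_pos)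
    have := Module.finite_of_finrank_pos (h'.finrank_eq_one.symm ▸ Nat.one_pos)
    exact ⟨Representation.Equiv.mk
      (LinearEquiv.ofFinrankEq S T (h.finrank_eq_one.trans h'.finrank_eq_one.symm)) fun g => by
        ext v
        simp [h.apply_eq, h'.apply_eq]⟩

/-- The one dimensional representation with a given character. -/
def characterRep {G : Type*} [Group G] (χ : G →* ℂˣ) : Representation ℂ G ℂ where
  toFun g := (χ g : ℂ) • LinearMap.id
  map_one' := by simp [Module.End.one_eq_id]
  map_mul' g h := by
    ext
    simp [mul_comm]

theorem characterRep_affords {G : Type*} [Group G] (χ : G →* ℂˣ) : (characterRep χ).Affords χ :=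
  ⟨Module.finrank_self ℂ, fun _ _ => rfl⟩

theorem Representation.Affords.isIrreducible {G S : Type*} [Group G] [AddCommGroup S] [Module ℂ S]
    {τ : Representation ℂ G S} {χ : G →* ℂˣ} (h : τ.Affords χ) : τ.IsIrreducible := by
  obtain ⟨s, hs⟩ := h.exists_ne_zero
  have hS : IsSimpleModule ℂ S := isSimpleModule_iff_finrank_eq_one.2 h.finrank_eq_one
  refine { exists_pair_ne := ⟨⊥, ⊤, fun h0 => hs ?_⟩, eq_bot_or_eq_top := fun W => ?_ }
  · have : s ∈ (⊤ : Subrepresentation τ) := Submodule.mem_top (R := ℂ)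
    rw [← h0] at this
    exact (Submodule.mem_bot ℂ).1 this
  · exact (eq_bot_or_eq_top W.toSubmodule).imp
      (fun h => Subrepresentation.toSubmodule_injective h)
      (fun h => Subrepresentation.toSubmodule_injective h)

/-- The character of an irreducible representation of a finite commutative group. -/
def IrrClass.character (i : IrrClass G) : G →* ℂˣ := i.out.irreducible.exists_affords.choose

theorem IrrClass.affords (i : IrrClass G) : i.out.rep.Affords i.character :=
  i.out.irreducible.exists_affords.choose_spec

/-- The irreducible representations of a finite commutative group are its characters. -/
def irrClassEquiv (G : Type) [Group G] [IsMulCommutative G] [Finite G] : IrrClass G ≃ (G →* ℂˣ) :=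
  Equiv.ofBijective IrrClass.character ⟨fun i j hij => by
    have h := (i.affords.congr_equiv j.affords).2 hij
    rw [← Quotient.out_eq i, ← Quotient.out_eq j]
    exact Quotient.sound h, fun χ => by
    let S : IrrRep G := ⟨ℂ, characterRep χ, (characterRep_affords χ).isIrreducible⟩
    refine ⟨Quotient.mk _ S, ?_⟩
    have h : Nonempty ((Quotient.out (Quotient.mk (IrrRep.setoid G) S)).rep.Equiv S.rep) :=
      Quotient.exact (Quotient.out_eq (Quotient.mk (IrrRep.setoid G) S))
    exact ((IrrClass.affords (Quotient.mk _ S)).congr_equiv (characterRep_affords χ)).1 h⟩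

end Irreducible

/-! ### Multiplicities -/

section Multiplicity

variable {G : Type*} [Group G]

/-- The multiplicity of a character in a representation with a basis of eigenvectors. -/
theorem finrank_intertwiningMap {S W κ : Type*} [Fintype κ] [AddCommGroup S] [Module ℂ S]
    [AddCommGroup W] [Module ℂ W]
    {τ : Representation ℂ G S} {χ : G →* ℂˣ} (hτ : τ.Affords χ) {σ : Representation ℂ G W}
    (b : Module.Basis κ ℂ W) (ψ : κ → G →* ℂˣ) (hb : ∀ g k, σ g (b k) = (ψ k g : ℂ) • b k) :
    Module.finrank ℂ (Representation.IntertwiningMap τ σ) = Nat.card {k // ψ k = χ} := by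
  classical
  obtain ⟨s, hs⟩ := hτ.exists_ne_zero
  have hspan := (finrank_eq_one_iff_of_nonzero' s hs).1 hτ.finrank_eq_one
  let e : ℂ ≃ₗ[ℂ] S := LinearEquiv.toSpanNonzeroSingleton ℂ S s hs |>.trans
      (LinearEquiv.ofTop _ ((finrank_eq_one_iff_of_nonzero s hs).1 hτ.finrank_eq_one))
  have hrepr : ∀ g w k, b.repr (σ g w) k = ψ k g * b.repr w k := fun g w k => by
    conv_lhs => rw [← b.sum_repr w]
    simp only [map_sum, map_smul, hb, Finsupp.coe_finsetSum, Finset.sum_apply, Finsupp.smul_apply,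
      Module.Basis.repr_self, Finsupp.single_apply, smul_eq_mul]
    simp [mul_comm]
  -- An intertwining map is determined by the image of `s`, which may be any vector of weight `χ`,
  -- that is, any combination of the `b k` with `ψ k = χ`.
  let F : Representation.IntertwiningMap τ σ →ₗ[ℂ] ({k // ψ k = χ} → ℂ) :=
    { toFun := fun f k => b.repr (f s) k
      map_add' := fun f g => by ext; simp
      map_smul' := fun c f => by ext; simp }
  have hF : Function.Bijective F := by
    constructor
    · rw [← LinearMap.ker_eq_bot, LinearMap.ker_eq_bot']
      intro f hf
      have hfs : f s = 0 := by
        apply b.repr.injective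
        ext k
        by_cases hk : ψ k = χ
        · simpa using! congrFun hf ⟨k, hk⟩
        -- This coordinate is scaled both by `χ g` and by `ψ k g`, so it vanishes once some `g`
        -- separates the two characters.
        · obtain ⟨g, hg⟩ : ∃ g, ψ k g ≠ χ g := by
            by_contra! h
            exact hk (MonoidHom.ext h)
          have h1 := hrepr g (f s) k
          rw [← f.isIntertwining, hτ.apply_eq, map_smul, map_smul, Finsupp.smul_apply,
            smul_eq_mul] at h1
          have h2 : ((χ g : ℂ) - ψ k g) * b.repr (f s) k = 0 := by rw [sub_mul, h1, sub_self]
          rw [map_zero, Finsupp.zero_apply]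
          refine (mul_eq_zero.1 h2).resolve_left fun h => hg (Units.ext (sub_eq_zero.1 h).symm)
      apply Representation.IntertwiningMap.ext
      ext v
      obtain ⟨c, rfl⟩ := hspan v
      simp [hfs]
    · intro a
      let w : W := ∑ k : {k // ψ k = χ}, a k • b k
      have hw : ∀ g, σ g w = (χ g : ℂ) • w := fun g => by
        simp only [w, map_sum, map_smul, hb, Finset.smul_sum]
        refine Finset.sum_congr rfl fun k _ => ?_
        rw [k.2, smul_comm]
      let f : Representation.IntertwiningMap τ σ :=
        LinearMap.intertwiningMap_of_isIntertwiningMap τ σ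
          ((LinearMap.toSpanSingleton ℂ W w).comp e.symm.toLinearMap) fun g v => by
            rw [hτ.apply_eq]
            change e.symm ((χ g : ℂ) • v) • w = σ g (e.symm v • w)
            rw [map_smul, map_smul, hw, smul_assoc, smul_comm]
      have hes : e.symm s = 1 := by
        rw [LinearEquiv.symm_apply_eq]
        simp [e]
      have hfs : f s = w := by
        change e.symm s • w = w
        rw [hes, one_smul]
      refine ⟨f, ?_⟩
      ext k
      change b.repr (f s) k = a k
      rw [hfs]
      simp [w, Finsupp.single_apply, Subtype.val_inj]
  rw [(LinearEquiv.ofBijective F hF).finrank_eq, Module.finrank_fintype_fun_eq_card,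
    Nat.card_eq_fintype_card]

end Multiplicity

/-- The McKay multiplicities for a diagonalized representation of a finite commutative group. -/
theorem mcKayMultiplicity_eq {G V : Type} [Group G] [IsMulCommutative G] [Finite G] [AddCommGroup V] [Module ℂ V]
    {κ : Type*} [Fintype κ] (ρ : Representation ℂ G V) (b : Module.Basis κ ℂ V) (ψ : κ → G →* ℂˣ)
    (hb : ∀ g k, ρ g (b k) = (ψ k g : ℂ) • b k) (i j : IrrClass G) :
    mcKayMultiplicity ρ i j = Nat.card {k // ψ k * irrClassEquiv G i = irrClassEquiv G j} := by
  let c : Module.Basis Unit ℂ i.out.carrier :=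
    Module.basisUnique Unit i.affords.finrank_eq_one
  refine (finrank_intertwiningMap j.affords (b.tensorProduct c)
    (fun k => ψ k.1 * irrClassEquiv G i) fun g k => ?_).trans ?_
  · rw [Module.Basis.tensorProduct_apply', Representation.tprod_apply, TensorProduct.map_tmul, hb,
      i.affords.apply_eq, TensorProduct.smul_tmul_smul]
    rfl
  · exact Nat.card_congr ((Equiv.prodPUnit κ).subtypeEquiv fun k => Iff.rfl)


/-! ### Isomorphisms of quivers -/

section QuiverIso

variable {U V W : Type*} [Quiver U] [Quiver V] [Quiver W]

/-- Composition of isomorphisms of quivers. -/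
def QuiverIso.trans (e : QuiverIso U V) (f : QuiverIso V W) : QuiverIso U W where
  obj := e.obj.trans f.obj
  hom i j := (e.hom i j).trans (f.hom _ _)

/-- The inverse of an isomorphism of quivers. -/
def QuiverIso.symm (e : QuiverIso U V) : QuiverIso V U where
  obj := e.obj.symm
  hom i j := (Equiv.cast (by rw [e.obj.apply_symm_apply, e.obj.apply_symm_apply])).trans
    (e.hom (e.obj.symm i) (e.obj.symm j)).symm

/-- Isomorphic multigraphs have isomorphic double quivers. -/
def Multigraph.Iso.double {Γ Δ : Multigraph} (e : Γ.Iso Δ) : QuiverIso Γ.Double Δ.Double where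
  obj := e.vert
  hom i j := e.edge.subtypeEquiv fun a => by
    rw [e.ends_edge]
    exact (Sym2.map.injective e.vert.injective).eq_iff.symm

/-- An isomorphism of quivers identifies the arrows leaving corresponding vertices. -/
theorem QuiverIso.subsingleton_arrows (e : QuiverIso U V) {i : U}
    (h : Subsingleton (Σ j, (i ⟶ j))) : Subsingleton (Σ j, (e.obj i ⟶ j)) :=
  (Equiv.sigmaCongr e.obj fun j => e.hom i j).symm.subsingleton

end QuiverIso

/-- The quiver on a set with a self map `t` in which each vertex `x` gives one arrow `x ⟶ t x` and
one arrow `t x ⟶ x`. -/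
def OrbitQuiver {X : Type*} (_t : X → X) : Type _ := X

instance {X : Type*} (t : X → X) : Quiver (OrbitQuiver t) where
  Hom x y := PLift ((y : X) = t x) ⊕ PLift ((x : X) = t y)

/-- Equivalent propositions have equivalent lifts. -/
def pliftEquivOfIff {p q : Prop} (h : p ↔ q) : PLift p ≃ PLift q :=
  Equiv.plift.trans ((Equiv.ofIff h).trans Equiv.plift.symm)

/-- Conjugate self maps have isomorphic orbit quivers. -/
def OrbitQuiver.congr {X Y : Type*} {t : X → X} {u : Y → Y} (e : X ≃ Y)
    (h : ∀ x, e (t x) = u (e x)) : QuiverIso (OrbitQuiver t) (OrbitQuiver u) where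
  obj := e
  hom x y := Equiv.sumCongr
    (pliftEquivOfIff ⟨fun hy => (congrArg e hy).trans (h x),
      fun hy => e.injective (hy.trans (h x).symm)⟩)
    (pliftEquivOfIff ⟨fun hx => (congrArg e hx).trans (h y),
      fun hx => e.injective (hx.trans (h y).symm)⟩)

/-- The arrows to `t x` and to `t.symm x` lie in different summands, so they differ even when their
targets coincide. -/
theorem OrbitQuiver.not_subsingleton_arrows {X : Type*} (t : X ≃ X) (x : OrbitQuiver t) :
    ¬ Subsingleton (Σ y, (x ⟶ y)) := fun h => by
  let a : Σ y, (x ⟶ y) := ⟨t x, Sum.inl ⟨rfl⟩⟩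
  let b : Σ y, (x ⟶ y) := ⟨t.symm x, Sum.inr ⟨(t.apply_symm_apply x).symm⟩⟩
  exact Bool.noConfusion (congrArg (fun p : Σ y, (x ⟶ y) => Sum.isLeft p.2) (h.elim a b))

/-! ### The quivers attached to a finite subgroup of `ℂ*` -/

section Units

variable (G : Subgroup ℂˣ)

theorem natRepUnits_affords : (natRepUnits G).Affords G.subtype :=
  ⟨Module.finrank_self ℂ, fun _ _ => rfl⟩

/-- Replacing the Nakayama translation with arrows in the McKay quiver of a finite subgroup of
`ℂ*` gives the orbit quiver of the multiplication by the inclusion character. -/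
def nakayamaReplacedIso [Finite G] : QuiverIso (NakayamaReplacedQuiver (natRepUnits G))
    (OrbitQuiver fun χ : G →* ℂˣ => G.subtype * χ) where
  obj := irrClassEquiv G
  hom i j := Equiv.sumCongr
    ((finCongr (mcKayMultiplicity_eq (natRepUnits G) (Module.Basis.singleton Unit ℂ)
      (fun _ => G.subtype) (fun g k => by
        rw [Module.Basis.singleton_apply]; rfl) i j)).trans
        ((Finite.equivFin _).symm.trans
          { toFun := fun k => ⟨k.2.symm⟩
            invFun := fun h => ⟨(), h.down.symm⟩
            left_inv := fun _ => rfl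
            right_inv := fun _ => rfl }))
    -- The roles of `i` and `j` are swapped: an added arrow from `i` to `j` means `i = σ j`.
    (pliftEquivOfIff (isNakayamaTranslate_iff (natRepUnits_affords G) j.affords i.affords))

theorem unitsToSL2_injective : Function.Injective unitsToSL2 := fun z w h => by
  have h1 := congrFun (congrFun (congrArg Subtype.val h) 0) 0
  exact Units.ext h1

/-- A subgroup of `ℂ*` is isomorphic to its image in `SL(2, ℂ)`. -/
def diagonalEquiv : G ≃* G.map unitsToSL2 :=
  G.equivMapOfInjective unitsToSL2 unitsToSL2_injective

/-- The two characters of the natural representation of a diagonal subgroup of `SL(2, ℂ)`. -/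
def diagonalCharacter : Fin 2 → (G.map unitsToSL2 →* ℂˣ) :=
  ![G.subtype.comp (diagonalEquiv G).symm.toMonoidHom,
    G.subtype⁻¹.comp (diagonalEquiv G).symm.toMonoidHom]

theorem natRepSL2_basisFun (g : G.map unitsToSL2) (k : Fin 2) :
    natRepSL2 (G.map unitsToSL2) g (Pi.basisFun ℂ (Fin 2) k)
      = (diagonalCharacter G k g : ℂ) • Pi.basisFun ℂ (Fin 2) k := by
  obtain ⟨z, rfl⟩ := (diagonalEquiv G).surjective g
  have hz : natRepSL2 (G.map unitsToSL2) (diagonalEquiv G z)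
      = Matrix.toLin' !![((z : ℂˣ) : ℂ), 0; 0, (((z : ℂˣ)⁻¹ : ℂˣ) : ℂ)] := rfl
  rw [hz]
  ext l
  fin_cases k <;> fin_cases l <;> simp [diagonalCharacter]

instance [Finite G] : Finite (G.map unitsToSL2) := (diagonalEquiv G).toEquiv.finite_iff.1 inferInstance

/-- Two propositions as a predicate on `Fin 2`. -/
def finTwoSubtypeEquiv {p : Fin 2 → Prop} {q r : Prop} (hq : p 0 ↔ q) (hr : p 1 ↔ r) :
    {k // p k} ≃ PLift q ⊕ PLift r where
  toFun k := if h : k.1 = 0 then Sum.inl ⟨hq.1 (h ▸ k.2)⟩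
    else Sum.inr ⟨hr.1 (Fin.eq_one_of_ne_zero k.1 h ▸ k.2)⟩
  invFun := Sum.elim (fun h => ⟨0, hq.2 h.down⟩) (fun h => ⟨1, hr.2 h.down⟩)
  left_inv := by
    rintro ⟨k, hk⟩
    fin_cases k <;> rfl
  right_inv := by
    rintro (h | h) <;> rfl

/-- The McKay quiver of a finite diagonal subgroup of `SL(2, ℂ)` is the orbit quiver of the
multiplication by the first of its two characters. -/
def mcKayDiagonalIso [Finite G] : QuiverIso (McKayQuiver (natRepSL2 (G.map unitsToSL2)))
    (OrbitQuiver fun χ : G.map unitsToSL2 →* ℂˣ => diagonalCharacter G 0 * χ) where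
  obj := irrClassEquiv (G.map unitsToSL2)
  hom i j := (finCongr (mcKayMultiplicity_eq _ (Pi.basisFun ℂ (Fin 2)) (diagonalCharacter G)
      (natRepSL2_basisFun G) i j)).trans ((Finite.equivFin _).symm.trans
        (finTwoSubtypeEquiv eq_comm (by
          have h : diagonalCharacter G 1 = (diagonalCharacter G 0)⁻¹ := rfl
          rw [h]
          exact inv_mul_eq_iff_eq_mul (G := G.map unitsToSL2 →* ℂˣ))))

/-- Replacing the Nakayama translation with arrows in the McKay quiver of a finite subgroup of
`ℂ*` gives the McKay quiver of the corresponding diagonal subgroup of `SL(2, ℂ)`. -/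
def nakayamaReplacedMcKayIso [Finite G] : QuiverIso (NakayamaReplacedQuiver (natRepUnits G))
    (McKayQuiver (natRepSL2 (G.map unitsToSL2))) :=
  ((nakayamaReplacedIso G).trans
    -- Transport along `diagonalEquiv` is multiplicative and takes the inclusion character to
    -- `diagonalCharacter G 0`.
    (OrbitQuiver.congr (diagonalEquiv G).monoidHomCongrLeftEquiv fun _ => rfl)).trans
      (mcKayDiagonalIso G).symm

theorem nakayamaReplaced_not_subsingleton_arrows [Finite G]
    (i : NakayamaReplacedQuiver (natRepUnits G)) :
    ¬ Subsingleton (Σ j, (i ⟶ j)) := fun h =>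
  OrbitQuiver.not_subsingleton_arrows (Equiv.mulLeft G.subtype) _
    ((nakayamaReplacedIso G).subsingleton_arrows h)

end Units

/-! ### Type `Ã` -/

/-- The edges of a cycle between two given vertices. -/
def cycleEdgesEquiv {n : ℕ} (hn : (1 : Fin (n + 1)) ≠ 0) (i j : Fin (n + 1)) :
    {e : Fin (n + 1) // s(e, e + 1) = s(i, j)} ≃ PLift (j = i + 1) ⊕ PLift (i = j + 1) where
  -- The edge `e` runs from `e` to `e + 1`, so it starts either at `i` or at `j`. On a cycle with
  -- two vertices both cases can occur, one for each parallel edge.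
  toFun e := if h : e.1 = i then Sum.inl ⟨by
      obtain ⟨e, he⟩ := e
      obtain rfl : e = i := h
      exact (Sym2.congr_right.1 he).symm⟩
    else Sum.inr ⟨by
      obtain ⟨e, he⟩ := e
      obtain ⟨h1, -⟩ | ⟨h1, h2⟩ := Sym2.eq_iff.1 he
      · exact absurd h1 h
      · exact h2.symm.trans (congrArg (· + 1) h1)⟩
  invFun := Sum.elim (fun h => ⟨i, congrArg (fun k => s(i, k)) h.down.symm⟩)
    (fun h => ⟨j, (congrArg (fun k => s(j, k)) h.down.symm).trans Sym2.eq_swap⟩)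
  left_inv := by
    rintro ⟨e, he⟩
    by_cases h : e = i
    · simp [h]
    · obtain ⟨h1, -⟩ | ⟨h1, -⟩ := Sym2.eq_iff.1 he
      · exact absurd h1 h
      · subst h1
        simp [h]
  right_inv := by
    rintro (h | h)
    · simp
    · have hji : j ≠ i := by
        rintro rfl
        exact hn (left_eq_add.1 h.down)
      simp [hji]

/-- The double quiver of `Ã_n` is the orbit quiver of a cyclic permutation. -/
def affineADoubleIso (n : ℕ) (hn : 1 ≤ n) :
    QuiverIso (affineA n hn).Double (OrbitQuiver fun k : Fin (n + 1) => k + 1) where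
  obj := Equiv.refl _
  hom i j := cycleEdgesEquiv (fun h => (affineA n hn).loopless (0 : Fin (n + 1))
    (Sym2.mk_isDiag_iff.2 ((zero_add (1 : Fin (n + 1))).trans h).symm)) i j

theorem rootsOfUnity_subtype_pow (n : ℕ) : (rootsOfUnity (n + 1) ℂ).subtype ^ (n + 1) = 1 := by
  ext z
  simpa using congrArg Units.val z.2

/-- The characters of the group of roots of unity are the powers of the inclusion. -/
def rootsOfUnityCharacterEquiv (n : ℕ) : Fin (n + 1) ≃ (rootsOfUnity (n + 1) ℂ →* ℂˣ) :=
  Equiv.ofBijective (fun k => (rootsOfUnity (n + 1) ℂ).subtype ^ (k : ℕ)) (by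
    have hcard : Nat.card (rootsOfUnity (n + 1) ℂ) = n + 1 := by
      rw [Complex.card_rootsOfUnity]
    have : HasEnoughRootsOfUnity ℂ (Nat.card (rootsOfUnity (n + 1) ℂ)) := by
      rw [hcard]; infer_instance
    obtain ⟨e⟩ := IsCyclic.monoidHom_equiv_self (rootsOfUnity (n + 1) ℂ) ℂ
    have := Finite.of_equiv _ e.toEquiv.symm
    -- The dual group also has `n + 1` elements, so injectivity is enough; evaluating at a primitive
    -- root separates the powers.
    rw [Nat.bijective_iff_injective_and_card]
    refine ⟨fun a b hab => ?_, ?_⟩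
    · obtain ⟨z, hz⟩ := HasEnoughRootsOfUnity.exists_primitiveRoot ℂ (n + 1)
      have hz1 : hz.toRootsOfUnity.1.1 = z := rfl
      have h := congrArg Units.val (DFunLike.congr_fun hab hz.toRootsOfUnity)
      simp only [MonoidHom.pow_apply, Subgroup.subtype_apply, Units.val_pow_eq_pow_val, hz1] at h
      exact Fin.ext (hz.pow_inj a.2 b.2 h)
    · rw [Nat.card_congr e.toEquiv, hcard, Nat.card_fin])

/-- The double quiver of `Ã_n` is obtained from the McKay quiver of the group of roots of unity. -/
def affineAReplacedIso (n : ℕ) (hn : 1 ≤ n) : QuiverIso (affineA n hn).Double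
    (NakayamaReplacedQuiver (natRepUnits (rootsOfUnity (n + 1) ℂ))) :=
  ((affineADoubleIso n hn).trans (OrbitQuiver.congr (rootsOfUnityCharacterEquiv n) fun k => by
    change (rootsOfUnity (n + 1) ℂ).subtype ^ ((k + 1 : Fin (n + 1)) : ℕ) =
      (rootsOfUnity (n + 1) ℂ).subtype * (rootsOfUnity (n + 1) ℂ).subtype ^ (k : ℕ)
    -- The wrap-around in `Fin (n + 1)` is harmless because the inclusion character has trivial `(n
    -- + 1)`-th power.
    rw [← pow_succ', Fin.val_add, Fin.val_one', Nat.add_mod_mod,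
      ← pow_eq_pow_mod _ (rootsOfUnity_subtype_pow n)])).trans
    (nakayamaReplacedIso _).symm

/-! ### Types `D̃` and `Ẽ` -/

/-- A vertex all of whose edges are equal to one edge has at most one arrow leaving it in the double
quiver. -/
theorem Multigraph.subsingleton_arrows_double {Γ : Multigraph} {v : Γ.Vert} {e₀ : Γ.Edge}
    (h : ∀ e, v ∈ Γ.ends e → e = e₀) :
    Subsingleton (Σ j : Γ.Double, ((show Γ.Double from v) ⟶ j)) := by
  refine ⟨?_⟩
  rintro ⟨j, e, he⟩ ⟨k, f, hf⟩
  obtain rfl := h e (he ▸ Sym2.mem_mk_left v j)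
  obtain rfl := h f (hf ▸ Sym2.mem_mk_left v k)
  obtain rfl : j = k := Sym2.congr_right.1 (he.symm.trans hf)
  rfl

theorem affineD_exists_leaf (n : ℕ) (hn : 4 ≤ n) :
    ∃ v e₀, ∀ e, v ∈ (affineD n hn).ends e → e = e₀ := by
  -- Vertex `0` meets only edge `0`, the one to vertex `2`: all other edges have end points at least
  -- `1`.
  refine ⟨(⟨0, by omega⟩ : Fin (n + 1)), (⟨0, by omega⟩ : Fin n), fun e he => ?_⟩
  change Fin n at e
  simp only [affineD] at he
  split_ifs at he with h1 h2
  · exact Fin.ext h1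
  all_goals
    obtain h | h := Sym2.mem_iff.1 he
    all_goals
      have := congrArg Fin.val h
      dsimp only at this
      omega

theorem affineE6_exists_leaf : ∃ v e₀, ∀ e, v ∈ affineE6.ends e → e = e₀ :=
  ⟨(2 : Fin 7), (1 : Fin 6), show ∀ e : Fin 6, (2 : Fin 7) ∈
    (![s(0, 1), s(1, 2), s(0, 3), s(3, 4), s(0, 5), s(5, 6)] : Fin 6 → Sym2 (Fin 7)) e → e = 1 by
      decide⟩

theorem affineE7_exists_leaf : ∃ v e₀, ∀ e, v ∈ affineE7.ends e → e = e₀ :=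
  ⟨(7 : Fin 8), (6 : Fin 7), show ∀ e : Fin 7, (7 : Fin 8) ∈
    (![s(0, 1), s(1, 2), s(2, 3), s(0, 4), s(4, 5), s(5, 6), s(0, 7)] :
      Fin 7 → Sym2 (Fin 8)) e → e = 6 by decide⟩

theorem affineE8_exists_leaf : ∃ v e₀, ∀ e, v ∈ affineE8.ends e → e = e₀ :=
  ⟨(8 : Fin 9), (7 : Fin 8), show ∀ e : Fin 8, (8 : Fin 9) ∈
    (![s(0, 1), s(1, 2), s(2, 3), s(3, 4), s(4, 5), s(0, 6), s(6, 7), s(0, 8)] :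
      Fin 8 → Sym2 (Fin 9)) e → e = 7 by decide⟩

/-- The double quiver of a graph with a leaf is not obtained by replacing the Nakayama translation
with arrows. -/
theorem isEmpty_quiverIso_of_leaf {Γ Δ : Multigraph} (φ : Γ.Iso Δ)
    (h : ∃ v e₀, ∀ e, v ∈ Δ.ends e → e = e₀) (G : Subgroup ℂˣ) [Finite G] :
    IsEmpty (QuiverIso Γ.Double (NakayamaReplacedQuiver (natRepUnits G))) := by
  obtain ⟨v, e₀, hv⟩ := h
  exact ⟨fun f => nakayamaReplaced_not_subsingleton_arrows G _
    ((φ.double.symm.trans f).subsingleton_arrows (Multigraph.subsingleton_arrows_double hv))⟩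


end

/-! ### The characterization of type `Ã` -/

theorem mainTheorem7 (Γ : Multigraph) (hΓ : IsAffineDynkin Γ) :
    ((∃ G : Subgroup ℂˣ, Finite G ∧
        Nonempty (QuiverIso Γ.Double (NakayamaReplacedQuiver (natRepUnits G)))) ↔
      IsAffineTypeA Γ) ∧
    ∀ G : Subgroup ℂˣ, Finite G →
      Nonempty (QuiverIso Γ.Double (NakayamaReplacedQuiver (natRepUnits G))) →
      Nonempty (QuiverIso Γ.Double (McKayQuiver (natRepSL2 (G.map unitsToSL2)))) := by
  refine ⟨⟨?_, ?_⟩, ?_⟩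
  · rintro ⟨G, hG, ⟨f⟩⟩
    obtain h | ⟨n, hn, ⟨φ⟩⟩ | ⟨⟨φ⟩⟩ | ⟨⟨φ⟩⟩ | ⟨⟨φ⟩⟩ := hΓ
    · exact h
    · exact (isEmpty_quiverIso_of_leaf φ (affineD_exists_leaf n hn) G).elim f
    · exact (isEmpty_quiverIso_of_leaf φ affineE6_exists_leaf G).elim f
    · exact (isEmpty_quiverIso_of_leaf φ affineE7_exists_leaf G).elim f
    · exact (isEmpty_quiverIso_of_leaf φ affineE8_exists_leaf G).elim f
  · rintro ⟨n, hn, ⟨φ⟩⟩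
    exact ⟨rootsOfUnity (n + 1) ℂ, inferInstance, ⟨φ.double.trans (affineAReplacedIso n hn)⟩⟩
  · rintro G hG ⟨f⟩
    exact ⟨f.trans (nakayamaReplacedMcKayIso G)⟩
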